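/- Let $S$ and $E$ be quantum systems with finite-dimensional Hilbert spaces. A state is a positive semidefinite operator of trace one. For states $\rho,\tau$ the quantum relative entropy is $D(\rho\|\tau)=\mathrm{Tr}[\rho\log\rho]-\mathrm{Tr}[\rho\log\tau]$ if $\operatorname{supp}\rho\subseteq\operatorname{supp}\tau$ and $D(\rho\|\tau)=+\infty$ otherwise, where $\log$ is the natural logarithm and the logarithm and negative powers of an operator are evaluated on its support only. Let $\mathcal T$ be a quantum channel (a completely positive trace-preserving linear map) on $S$ with a full-rank fixed state $\tau_S=\mathcal T(\tau_S)$, and suppose that it has a dilation $$\mathcal T(\cdot)=\mathrm{Tr}_E\big[U\big((\cdot)\otimes\rho_E\big)U^\dagger\big]$$ with a unitary $U$ on $S\otimes E$ and a state $\rho_E$ on $E$ such that $U(\tau_S\otimes\rho_E)U^\dagger=\tau_S\otimes\rho_E$. Put $\mathcal R(\cdot)=\mathrm{Tr}_E\big[U^\dagger\big((\cdot)\otimes\rho_E\big)U\big]$. Then the following hold. (1) For every state $\rho_S$ on $S$, with $\sigma_S=\mathcal T(\rho_S)$, both $D(\rho_S\|\tau_S)$ and $D(\sigma_S\|\tau_S)$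 are finite, and $$D(\rho_S\|\tau_S)-D(\sigma_S\|\tau_S)=D\big(\rho_S\otimes\rho_E\,\big\|\,U^\dagger(\sigma_S\otimes\rho_E)U\big)\ \ge\ D\big(\rho_S\,\big\|\,\mathcal R(\sigma_S)\big).$$ (2) $\mathcal R$ is the Petz recovery map of $\mathcal T$ with respect to $\tau_S$: for every operator $X$ on $S$, $$\mathcal R(X)=\tau_S^{1/2}\,\mathcal T^\dagger\big[\mathcal T(\tau_S)^{-1/2}\,X\,\mathcal T(\tau_S)^{-1/2}\big]\,\tau_S^{1/2},$$ where $\mathcal T^\dagger$ is the adjoint of $\mathcal T$ with respect to the Hilbert-Schmidt inner product $\langle X,Y\rangle=\mathrm{Tr}[X^\dagger Y]$. -/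

import Mathlib

open scoped Kronecker ComplexOrder

noncomputable section

namespace QRecovery

/-- `ρ` is a density matrix (quantum state): positive semidefinite with unit trace. -/
def IsState {n : Type*} [Fintype n] (ρ : Matrix n n ℂ) : Prop :=
  ρ.PosSemidef ∧ ρ.trace = 1

/-- Partial trace over the second tensor factor. -/
def partialTrace {S E : Type*} [Fintype E] (M : Matrix (S × E) (S × E) ℂ) : Matrix S S ℂ :=
  Matrix.of fun i j => ∑ e, M (i, e) (j, e)

/-- The amplification `Φ ⊗ id_k` of a linear map between matrix algebras. -/
def amplify {m n k : Type*} (Φ : Matrix m m ℂ →ₗ[ℂ] Matrix n n ℂ)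
    (M : Matrix (m × k) (m × k) ℂ) : Matrix (n × k) (n × k) ℂ :=
  Matrix.of fun p q => Φ (Matrix.of fun i j => M (i, p.2) (j, q.2)) p.1 q.1

/-- `Φ` is a quantum channel: a completely positive and trace-preserving linear map. -/
def IsChannel {m n : Type*} [Fintype m] [Fintype n]
    (Φ : Matrix m m ℂ →ₗ[ℂ] Matrix n n ℂ) : Prop :=
  (∀ (k : ℕ) (M : Matrix (m × Fin k) (m × Fin k) ℂ),
      M.PosSemidef → (amplify Φ M).PosSemidef) ∧
    ∀ X : Matrix m m ℂ, (Φ X).trace = X.trace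

/-- The support of a Hermitian matrix, i.e. its range (the orthogonal complement of its kernel). -/
def supp {n : Type*} [Fintype n] (A : Matrix n n ℂ) : Submodule ℂ (n → ℂ) :=
  LinearMap.range A.mulVecLin

/-- The logarithm (base `e`) of a positive semidefinite matrix, evaluated only on its support:
`Real.log 0 = 0`, so the kernel is sent to `0`. -/
def matLog {n : Type*} [Fintype n] [DecidableEq n] (A : Matrix n n ℂ) : Matrix n n ℂ :=
  cfc Real.log A

/-- The real power `A ^ s` of a positive semidefinite matrix, evaluated only on its support
when `s ≠ 0`: then `(0 : ℝ) ^ s = 0`, so the kernel is sent to `0`. -/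
def matPow {n : Type*} [Fintype n] [DecidableEq n] (A : Matrix n n ℂ) (s : ℝ) : Matrix n n ℂ :=
  cfc (fun x : ℝ => x ^ s) A

open Classical in
/-- Quantum relative entropy `D(ρ‖τ) = Tr[ρ log ρ] - Tr[ρ log τ]` if `supp ρ ⊆ supp τ`,
and `+∞` otherwise. For positive semidefinite arguments the two traces are real. -/
def relEntropy {n : Type*} [Fintype n] [DecidableEq n] (ρ τ : Matrix n n ℂ) : EReal :=
  if supp ρ ≤ supp τ then
    (((ρ * matLog ρ).trace - (ρ * matLog τ).trace).re : EReal)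
  else ⊤

/-- The adjoint of a linear map between matrix algebras with respect to the Hilbert-Schmidt
inner product `⟨X, Y⟩ = Tr[X† Y]`. -/
def hsAdjoint {m n : Type*} [Fintype n] [DecidableEq m]
    (Φ : Matrix m m ℂ →ₗ[ℂ] Matrix n n ℂ) : Matrix n n ℂ →ₗ[ℂ] Matrix m m ℂ where
  toFun Y := Matrix.of fun i j => ((Φ (Matrix.single i j 1)).conjTranspose * Y).trace
  map_add' X Y := by
    ext i j
    simp [Matrix.mul_add, Matrix.trace_add]
  map_smul' c X := by
    ext i j
    simp [Matrix.trace_smul]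

/-- The defining property of the adjoint. -/
theorem hsAdjoint_spec {m n : Type*} [Fintype m] [Fintype n] [DecidableEq m]
    (Φ : Matrix m m ℂ →ₗ[ℂ] Matrix n n ℂ) (X : Matrix m m ℂ) (Y : Matrix n n ℂ) :
    (X.conjTranspose * hsAdjoint Φ Y).trace = ((Φ X).conjTranspose * Y).trace := by
  have hX : Φ X = ∑ i, ∑ j, X i j • Φ (Matrix.single i j 1) := by
    conv_lhs => rw [Matrix.matrix_eq_sum_single X]
    simp only [map_sum]
    refine Finset.sum_congr rfl fun i _ => Finset.sum_congr rfl fun j _ => ?_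
    rw [← map_smul, Matrix.smul_single, smul_eq_mul, mul_one]
  rw [hX]
  simp only [Matrix.conjTranspose_sum, Matrix.conjTranspose_smul, Matrix.sum_mul,
    Matrix.trace_sum, Matrix.smul_mul, Matrix.trace_smul]
  simp only [Matrix.trace, Matrix.diag, Matrix.mul_apply, Matrix.conjTranspose_apply,
    hsAdjoint, LinearMap.coe_mk, AddHom.coe_mk, Matrix.of_apply, smul_eq_mul]
  rw [Finset.sum_comm]

/-- The Petz recovery map of `Φ` with respect to `θ`:
`Y ↦ θ^{1/2} Φ†[Φ(θ)^{-1/2} Y Φ(θ)^{-1/2}] θ^{1/2}`. -/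
def petzMap {m n : Type*} [Fintype m] [DecidableEq m] [Fintype n] [DecidableEq n]
    (Φ : Matrix m m ℂ →ₗ[ℂ] Matrix n n ℂ) (θ : Matrix m m ℂ) (Y : Matrix n n ℂ) :
    Matrix m m ℂ :=
  matPow θ (1 / 2) *
    hsAdjoint Φ (matPow (Φ θ) (-1 / 2) * Y * matPow (Φ θ) (-1 / 2)) *
    matPow θ (1 / 2)

end QRecovery

end

/-! Let ω = U(ρ ⊗ ρE)U† and σ = Tr_E ω. Since the logarithm of a tensor product splits into a sum
(`matLog_kronecker`), the relative entropy of the dilated pair involves only the entropies of ρ, σ,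
ρE and the term Tr[ω(1 ⊗ log ρE)]. Invariance of τ ⊗ ρE evaluates that term as Tr[ρ log τ] + Tr[ρE
log ρE] - Tr[σ log τ], which yields the equality in (1). The splitting has support projections in
it; they are harmless because ω lives on supp σ ⊗ supp ρE.

The inequality is monotonicity under Tr_E. With L_B and R_A left and right multiplication, Tr[A (L_B
+ s R_A)⁻¹ A] is the maximum of a concave quadratic functional of X. On matrices X ⊗ 1 this
functional is the one of the marginals, so Tr_E can only lower the maximum. These maxima are the
s-derivatives of ∑ p log(b + s a) for joint spectral weights p, and comparing s = 0 with s → ∞ gives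
the relative entropies (`sum_mul_log_sub_le`).

For (2), U commutes with τ^{1/2} ⊗ ρE^{1/2}, which can therefore be moved through U in the formula
for the Petz map. -/

namespace QRecovery

open Matrix

/-! ### Functional calculus in explicit eigenbases, and supports -/

section FunctionalCalculus

variable {n m : Type*} [Fintype n] [DecidableEq n] [Fintype m] [DecidableEq m]

/-- The Hermitian matrix with eigenvalues `a` and eigenvectors the columns of `V`. -/
def ofSpectrum (V : Matrix n n ℂ) (a : n → ℝ) : Matrix n n ℂ :=
  V * diagonal (fun i => (a i : ℂ)) * Vᴴ

theorem exists_eq_ofSpectrum {A : Matrix n n ℂ} (hA : A.IsHermitian) :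
    ∃ V ∈ unitaryGroup n ℂ, ∃ a : n → ℝ, A = ofSpectrum V a ∧
      ∀ f : ℝ → ℝ, cfc f A = ofSpectrum V (f ∘ a) := by
  refine ⟨hA.eigenvectorUnitary, hA.eigenvectorUnitary.2, hA.eigenvalues, ?_, fun f => ?_⟩
  · have h := hA.spectral_theorem
    rw [Unitary.conjStarAlgAut_apply] at h
    exact h
  · rw [hA.cfc_eq, IsHermitian.cfc, Unitary.conjStarAlgAut_apply]
    rfl

theorem conjTranspose_ofSpectrum (V : Matrix n n ℂ) (a : n → ℝ) :
    (ofSpectrum V a)ᴴ = ofSpectrum V a := by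
  simp only [ofSpectrum, conjTranspose_mul, conjTranspose_conjTranspose, diagonal_conjTranspose,
    Matrix.mul_assoc]
  congr
  ext i
  simp

theorem conjTranspose_mul_self_of_mem {V : Matrix n n ℂ} (hV : V ∈ unitaryGroup n ℂ) :
    Vᴴ * V = 1 := mem_unitaryGroup_iff'.1 hV

theorem mul_conjTranspose_self_of_mem {V : Matrix n n ℂ} (hV : V ∈ unitaryGroup n ℂ) :
    V * Vᴴ = 1 := mem_unitaryGroup_iff.1 hV

/-- Any diagonalisation may be used: W†V intertwines the two diagonal matrices, so its nonzero
entries join equal eigenvalues only, and it intertwines their images under `f` too. -/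
theorem cfc_ofSpectrum {V : Matrix n n ℂ} (hV : V ∈ unitaryGroup n ℂ) (b : n → ℝ) (f : ℝ → ℝ) :
    cfc f (ofSpectrum V b) = ofSpectrum V (f ∘ b) := by
  obtain ⟨W, hW, a, h1, h2⟩ := exists_eq_ofSpectrum (A := ofSpectrum V b)
    (conjTranspose_ofSpectrum V b)
  rw [h2]
  have hVV := conjTranspose_mul_self_of_mem hV
  have hWW := conjTranspose_mul_self_of_mem hW
  have hVV' := mul_conjTranspose_self_of_mem hV
  have hWW' := mul_conjTranspose_self_of_mem hW
  have key : diagonal (fun i => (a i : ℂ)) * (Wᴴ * V) =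
      (Wᴴ * V) * diagonal (fun i => (b i : ℂ)) := by
    have h3 : Wᴴ * ofSpectrum V b * V = Wᴴ * ofSpectrum W a * V := by rw [h1]
    calc _ = (Wᴴ * W) * diagonal (fun i => (a i : ℂ)) * (Wᴴ * V) := by rw [hWW, Matrix.one_mul]
      _ = Wᴴ * ofSpectrum W a * V := by simp only [ofSpectrum, Matrix.mul_assoc]
      _ = (Wᴴ * V) * diagonal (fun i => (b i : ℂ)) * (Vᴴ * V) := by
          rw [← h3]; simp only [ofSpectrum, Matrix.mul_assoc]
      _ = _ := by rw [hVV, Matrix.mul_one]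
  have key2 : diagonal (fun i => (f (a i) : ℂ)) * (Wᴴ * V) =
      (Wᴴ * V) * diagonal (fun i => (f (b i) : ℂ)) := by
    ext i j
    have h4 := congr_fun (congr_fun key i) j
    rw [diagonal_mul, mul_diagonal] at h4 ⊢
    by_cases h0 : (Wᴴ * V) i j = 0
    · simp [h0]
    · rw [mul_comm] at h4
      have h5 := Complex.ofReal_injective (mul_left_cancel₀ h0 h4)
      rw [h5, mul_comm]
  calc ofSpectrum W (f ∘ a) = W * (diagonal (fun i => (f (a i) : ℂ)) * (Wᴴ * V)) * Vᴴ := by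
        simp only [ofSpectrum, Matrix.mul_assoc, hVV', Matrix.mul_one]; rfl
    _ = (W * Wᴴ) * (V * diagonal (fun i => (f (b i) : ℂ)) * Vᴴ) := by
        rw [key2]; simp only [Matrix.mul_assoc]
    _ = _ := by rw [hWW', Matrix.one_mul]; rfl

theorem ofSpectrum_mul {V : Matrix n n ℂ} (hV : V ∈ unitaryGroup n ℂ) (a b : n → ℝ) :
    ofSpectrum V a * ofSpectrum V b = ofSpectrum V (a * b) := by
  calc _ = V * diagonal (fun i => (a i : ℂ)) * (Vᴴ * V) * (diagonal (fun i => (b i : ℂ)) * Vᴴ) := by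
        simp only [ofSpectrum, Matrix.mul_assoc]
    _ = V * (diagonal (fun i => (a i : ℂ)) * diagonal (fun i => (b i : ℂ))) * Vᴴ := by
        rw [conjTranspose_mul_self_of_mem hV]; simp only [Matrix.mul_assoc, Matrix.one_mul]
    _ = _ := by
        rw [diagonal_mul_diagonal, ofSpectrum]
        simp

theorem ofSpectrum_add (V : Matrix n n ℂ) (a b : n → ℝ) :
    ofSpectrum V a + ofSpectrum V b = ofSpectrum V (a + b) := by
  simp only [ofSpectrum, ← Matrix.add_mul, ← Matrix.mul_add, diagonal_add]
  simp

theorem ofSpectrum_one {V : Matrix n n ℂ} (hV : V ∈ unitaryGroup n ℂ) :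
    ofSpectrum V 1 = 1 := by
  simp [ofSpectrum, mul_conjTranspose_self_of_mem hV]

theorem conj_ofSpectrum (W V : Matrix n n ℂ) (a : n → ℝ) :
    Wᴴ * ofSpectrum V a * W = ofSpectrum (Wᴴ * V) a := by
  simp only [ofSpectrum, conjTranspose_mul, conjTranspose_conjTranspose, Matrix.mul_assoc]

theorem ofSpectrum_kronecker (V : Matrix n n ℂ) (W : Matrix m m ℂ) (a : n → ℝ) (b : m → ℝ) :
    ofSpectrum V a ⊗ₖ ofSpectrum W b = ofSpectrum (V ⊗ₖ W) (fun p => a p.1 * b p.2) := by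
  simp only [ofSpectrum, mul_kronecker_mul, conjTranspose_kronecker, diagonal_kronecker_diagonal]
  simp

theorem kronecker_mem_unitaryGroup {V : Matrix n n ℂ} {W : Matrix m m ℂ}
    (hV : V ∈ unitaryGroup n ℂ) (hW : W ∈ unitaryGroup m ℂ) :
    V ⊗ₖ W ∈ unitaryGroup (n × m) ℂ := by
  rw [mem_unitaryGroup_iff, star_eq_conjTranspose, conjTranspose_kronecker, ← mul_kronecker_mul,
    mul_conjTranspose_self_of_mem hV, mul_conjTranspose_self_of_mem hW, one_kronecker_one]

theorem ofSpectrum_nonneg {V : Matrix n n ℂ} (hV : V ∈ unitaryGroup n ℂ) {a : n → ℝ}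
    (h : (ofSpectrum V a).PosSemidef) (i : n) : 0 ≤ a i := by
  have h1 := h.conjTranspose_mul_mul_same V
  have h2 : Vᴴ * ofSpectrum V a * V = diagonal (fun i => (a i : ℂ)) := by
    rw [conj_ofSpectrum, conjTranspose_mul_self_of_mem hV, ofSpectrum]; simp
  rw [h2] at h1
  exact_mod_cast (posSemidef_diagonal_iff.1 h1) i

theorem ofSpectrum_pos {V : Matrix n n ℂ} (hV : V ∈ unitaryGroup n ℂ) {a : n → ℝ}
    (h : (ofSpectrum V a).PosDef) (i : n) : 0 < a i := by
  refine lt_of_le_of_ne (ofSpectrum_nonneg hV h.posSemidef i) fun h0 => ?_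
  have h1 := h.isUnit
  rw [ofSpectrum, isUnit_iff_isUnit_det, det_mul, det_mul, det_diagonal,
    Finset.prod_eq_zero (Finset.mem_univ i) (by simp [← h0])] at h1
  simp at h1

theorem cfc_unitary_conj {U A : Matrix n n ℂ} (hU : U ∈ unitaryGroup n ℂ) (hA : A.IsHermitian)
    (f : ℝ → ℝ) : cfc f (Uᴴ * A * U) = Uᴴ * cfc f A * U := by
  obtain ⟨V, hV, a, h1, h2⟩ := exists_eq_ofSpectrum hA
  rw [h2, h1, conj_ofSpectrum, conj_ofSpectrum, cfc_ofSpectrum]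
  exact mul_mem (Unitary.star_mem hU) hV

/-- The orthogonal projection onto the support of a Hermitian matrix. -/
noncomputable def suppProj (A : Matrix n n ℂ) : Matrix n n ℂ := cfc (fun x : ℝ => if x = 0 then 0 else 1) A

theorem conjTranspose_suppProj {A : Matrix n n ℂ} (hA : A.IsHermitian) :
    (suppProj A)ᴴ = suppProj A := by
  obtain ⟨V, hV, a, h1, h2⟩ := exists_eq_ofSpectrum hA
  rw [suppProj, h2, conjTranspose_ofSpectrum]

theorem suppProj_mul_self {A : Matrix n n ℂ} (hA : A.IsHermitian) :
    suppProj A * suppProj A = suppProj A := by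
  obtain ⟨V, hV, a, h1, h2⟩ := exists_eq_ofSpectrum hA
  rw [suppProj, h2, ofSpectrum_mul hV]
  congr 1; ext i; simp

theorem mul_suppProj {A : Matrix n n ℂ} (hA : A.IsHermitian) : A * suppProj A = A := by
  obtain ⟨V, hV, a, h1, h2⟩ := exists_eq_ofSpectrum hA
  rw [suppProj, h2, h1, ofSpectrum_mul hV]
  congr 1; ext i; by_cases h : a i = 0 <;> simp [h]

theorem exists_suppProj_eq_mul {A : Matrix n n ℂ} (hA : A.IsHermitian) :
    ∃ Y, suppProj A = A * Y := by
  obtain ⟨V, hV, a, h1, h2⟩ := exists_eq_ofSpectrum hA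
  -- This is the pseudo-inverse, as `0⁻¹ = 0`.
  refine ⟨ofSpectrum V (fun i => (a i)⁻¹), ?_⟩
  rw [suppProj, h2, h1, ofSpectrum_mul hV]
  congr 1; ext i; by_cases h : a i = 0 <;> simp [h]

theorem suppProj_of_posDef {A : Matrix n n ℂ} (hA : A.PosDef) : suppProj A = 1 := by
  obtain ⟨V, hV, a, h1, h2⟩ := exists_eq_ofSpectrum hA.isHermitian
  rw [suppProj, h2, ← ofSpectrum_one hV]
  rw [h1] at hA
  congr 1; ext i; simp [(ofSpectrum_pos hV hA i).ne']

/-- The projections account for `Real.log 0 = 0`: a zero eigenvalue of one factor kills the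
logarithm of the other. -/
theorem matLog_kronecker {A : Matrix n n ℂ} {B : Matrix m m ℂ} (hA : A.IsHermitian)
    (hB : B.IsHermitian) :
    matLog (A ⊗ₖ B) = matLog A ⊗ₖ suppProj B + suppProj A ⊗ₖ matLog B := by
  obtain ⟨V, hV, a, h1, h2⟩ := exists_eq_ofSpectrum hA
  obtain ⟨W, hW, b, h3, h4⟩ := exists_eq_ofSpectrum hB
  simp only [suppProj, matLog, h2, h4]
  rw [h1, h3, ofSpectrum_kronecker, ofSpectrum_kronecker, ofSpectrum_kronecker, ofSpectrum_add,
    cfc_ofSpectrum (kronecker_mem_unitaryGroup hV hW)]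
  congr 1
  ext ⟨i, j⟩
  by_cases h : a i = 0 <;> by_cases h' : b j = 0 <;> simp [h, h', Real.log_mul]

theorem matPow_kronecker {A : Matrix n n ℂ} {B : Matrix m m ℂ} (hA : A.PosSemidef)
    (hB : B.PosSemidef) (s : ℝ) : matPow (A ⊗ₖ B) s = matPow A s ⊗ₖ matPow B s := by
  obtain ⟨V, hV, a, h1, h2⟩ := exists_eq_ofSpectrum hA.isHermitian
  obtain ⟨W, hW, b, h3, h4⟩ := exists_eq_ofSpectrum hB.isHermitian
  simp only [matPow, h2, h4]
  rw [h1] at hA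
  rw [h3] at hB
  rw [h1, h3, ofSpectrum_kronecker, ofSpectrum_kronecker,
    cfc_ofSpectrum (kronecker_mem_unitaryGroup hV hW)]
  congr 1
  ext ⟨i, j⟩
  simp [Real.mul_rpow (ofSpectrum_nonneg hV hA i) (ofSpectrum_nonneg hW hB j)]

theorem matPow_half_mul_self {A : Matrix n n ℂ} (hA : A.PosSemidef) :
    matPow A (1 / 2) * matPow A (1 / 2) = A := by
  obtain ⟨V, hV, a, h1, h2⟩ := exists_eq_ofSpectrum hA.isHermitian
  rw [matPow, h2, ofSpectrum_mul hV]
  rw [h1] at hA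
  conv_rhs => rw [h1]
  congr 1; ext i
  simp only [Pi.mul_apply, Function.comp_apply, ← Real.sqrt_eq_rpow]
  exact Real.mul_self_sqrt (ofSpectrum_nonneg hV hA i)

theorem matPow_mul_matPow_neg {A : Matrix n n ℂ} (hA : A.PosDef) (s t : ℝ) (hst : s + t = 0) :
    matPow A s * matPow A t = 1 := by
  obtain ⟨V, hV, a, h1, h2⟩ := exists_eq_ofSpectrum hA.isHermitian
  rw [matPow, matPow, h2, h2, ofSpectrum_mul hV, ← ofSpectrum_one hV]
  rw [h1] at hA
  congr 1; ext i
  simp [← Real.rpow_add (ofSpectrum_pos hV hA i), hst]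

theorem conjTranspose_matPow {A : Matrix n n ℂ} (hA : A.IsHermitian) (s : ℝ) :
    (matPow A s)ᴴ = matPow A s := by
  obtain ⟨V, hV, a, h1, h2⟩ := exists_eq_ofSpectrum hA
  rw [matPow, h2, conjTranspose_ofSpectrum]

/-- The trace is the squared Hilbert-Schmidt norm of M^{1/2} Q. -/
theorem mul_eq_zero_of_trace_mul_eq_zero {M Q : Matrix n n ℂ} (hM : M.PosSemidef) (hQ : Qᴴ = Q)
    (hQ2 : Q * Q = Q) (h : (M * Q).trace = 0) : M * Q = 0 := by
  have h1 : matPow M (1 / 2) * Q = 0 := by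
    rw [← trace_conjTranspose_mul_self_eq_zero_iff, conjTranspose_mul, hQ,
      conjTranspose_matPow hM.isHermitian, Matrix.mul_assoc, ← Matrix.mul_assoc (matPow M (1 / 2)),
      matPow_half_mul_self hM, trace_mul_comm, Matrix.mul_assoc, hQ2, h]
  rw [← matPow_half_mul_self hM, Matrix.mul_assoc, h1, Matrix.mul_zero]

theorem supp_le_supp_iff {A B : Matrix n n ℂ} : supp A ≤ supp B ↔ ∃ Y, A = B * Y := by
  constructor
  · intro h
    have h1 : ∀ j, ∃ y : n → ℂ, B *ᵥ y = A *ᵥ Pi.single j 1 := fun j =>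
      h ⟨Pi.single j 1, rfl⟩
    choose y hy using h1
    refine ⟨of fun i j => y j i, ?_⟩
    ext i j
    have := congr_fun (hy j) i
    rw [mulVec_single_one] at this
    exact this.symm
  · rintro ⟨Y, rfl⟩ x ⟨z, rfl⟩
    exact ⟨Y *ᵥ z, by simp⟩

theorem supp_le_supp_of_posDef {B : Matrix n n ℂ} (hB : B.PosDef) (A : Matrix n n ℂ) :
    supp A ≤ supp B :=
  supp_le_supp_iff.2 ⟨B⁻¹ * A, by
    rw [← Matrix.mul_assoc, mul_nonsing_inv _ ((isUnit_iff_isUnit_det _).1 hB.isUnit),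
      Matrix.one_mul]⟩

end FunctionalCalculus

/-! ### Partial trace and supports of marginals -/

section PartialTrace

variable {S E : Type*} [Fintype E]

theorem partialTrace_kronecker (A : Matrix S S ℂ) (B : Matrix E E ℂ) :
    partialTrace (A ⊗ₖ B) = B.trace • A := by
  ext i j
  simp [partialTrace, trace, ← Finset.mul_sum, mul_comm]

theorem partialTrace_mul_kronecker_one [Fintype S] [DecidableEq E] (M : Matrix (S × E) (S × E) ℂ) (X : Matrix S S ℂ) :
    partialTrace (M * (X ⊗ₖ (1 : Matrix E E ℂ))) = partialTrace M * X := by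
  ext i j
  simp only [partialTrace, of_apply, mul_apply, Fintype.sum_prod_type, kroneckerMap_apply,
    one_apply, Finset.sum_mul]
  rw [Finset.sum_comm]
  simp

theorem partialTrace_kronecker_one_mul [Fintype S] [DecidableEq E] (M : Matrix (S × E) (S × E) ℂ) (X : Matrix S S ℂ) :
    partialTrace ((X ⊗ₖ (1 : Matrix E E ℂ)) * M) = X * partialTrace M := by
  ext i j
  simp only [partialTrace, of_apply, mul_apply, Fintype.sum_prod_type, kroneckerMap_apply,
    one_apply, Finset.mul_sum]
  rw [Finset.sum_comm]
  simp

theorem trace_partialTrace [Fintype S] (M : Matrix (S × E) (S × E) ℂ) : (partialTrace M).trace = M.trace := by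
  simp [partialTrace, trace, Fintype.sum_prod_type]

theorem posSemidef_partialTrace {M : Matrix (S × E) (S × E) ℂ} (hM : M.PosSemidef) :
    (partialTrace M).PosSemidef := by
  have h : partialTrace M = ∑ e, M.submatrix (fun i => (i, e)) (fun i => (i, e)) := by
    ext i j
    simp [partialTrace, Matrix.sum_apply]
  rw [h]
  exact posSemidef_sum _ fun e _ => hM.submatrix _

/-- With P the support projection of the marginal, Tr[M((1 - P) ⊗ 1)] = Tr[(Tr_E M)(1 - P)] = 0, and
positivity of M upgrades this to a matrix identity. -/
theorem mul_suppProj_partialTrace [Fintype S] [DecidableEq S] [DecidableEq E] {M : Matrix (S × E) (S × E) ℂ} (hM : M.PosSemidef) :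
    M * (suppProj (partialTrace M) ⊗ₖ (1 : Matrix E E ℂ)) = M := by
  have hH := (posSemidef_partialTrace hM).isHermitian
  have h1 : M * ((1 - suppProj (partialTrace M)) ⊗ₖ (1 : Matrix E E ℂ)) = 0 := by
    apply mul_eq_zero_of_trace_mul_eq_zero hM
    · rw [conjTranspose_kronecker, conjTranspose_sub, conjTranspose_suppProj hH]
      simp
    · rw [← mul_kronecker_mul, Matrix.sub_mul, Matrix.mul_sub (suppProj _), suppProj_mul_self hH]
      simp
    · rw [← trace_partialTrace, partialTrace_mul_kronecker_one, Matrix.mul_sub, mul_suppProj hH]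
      simp
  have h2 : (1 : Matrix (S × E) (S × E) ℂ) = suppProj (partialTrace M) ⊗ₖ (1 : Matrix E E ℂ) +
      (1 - suppProj (partialTrace M)) ⊗ₖ (1 : Matrix E E ℂ) := by
    rw [← add_kronecker, add_sub_cancel, one_kronecker_one]
  conv_rhs => rw [← Matrix.mul_one M, h2, Matrix.mul_add, h1, add_zero]

theorem supp_partialTrace_le [Fintype S] [DecidableEq S] [DecidableEq E] {A B : Matrix (S × E) (S × E) ℂ} (hB : B.PosSemidef)
    (h : supp A ≤ supp B) : supp (partialTrace A) ≤ supp (partialTrace B) := by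
  obtain ⟨Y, hY⟩ := supp_le_supp_iff.1 h
  have hH := (posSemidef_partialTrace hB).isHermitian
  obtain ⟨Z, hZ⟩ := exists_suppProj_eq_mul hH
  have h1 : (suppProj (partialTrace B) ⊗ₖ (1 : Matrix E E ℂ)) * B = B := by
    have := congr_arg conjTranspose (mul_suppProj_partialTrace hB)
    rwa [conjTranspose_mul, conjTranspose_kronecker, conjTranspose_suppProj hH,
      hB.isHermitian.eq, conjTranspose_one] at this
  have h2 : (suppProj (partialTrace B) ⊗ₖ (1 : Matrix E E ℂ)) * A = A := by
    rw [hY, ← Matrix.mul_assoc, h1]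
  refine supp_le_supp_iff.2 ⟨Z * partialTrace A, ?_⟩
  rw [← Matrix.mul_assoc, ← hZ, ← partialTrace_kronecker_one_mul, h2]

end PartialTrace

/-! ### Monotonicity of relative entropy under the partial trace -/

section DataProcessing

open Filter Topology

variable {n : Type*} [Fintype n] [DecidableEq n]

theorem trace_ofSpectrum_mul_ofSpectrum (V W : Matrix n n ℂ) (a c : n → ℝ) :
    (ofSpectrum V a * ofSpectrum W c).trace.re =
      ∑ k : n × n, Complex.normSq ((Wᴴ * V) k.1 k.2) * a k.2 * c k.1 := by
  have h : (ofSpectrum V a * ofSpectrum W c).trace =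
      ((Wᴴ * V) * diagonal (fun i => (a i : ℂ)) * (Wᴴ * V)ᴴ *
        diagonal (fun i => (c i : ℂ))).trace := by
    rw [trace_mul_comm]
    simp only [ofSpectrum]
    rw [Matrix.mul_assoc, Matrix.mul_assoc, trace_mul_comm, Matrix.mul_assoc, trace_mul_comm]
    simp only [conjTranspose_mul, conjTranspose_conjTranspose, Matrix.mul_assoc]
  rw [h, trace, Fintype.sum_prod_type, Complex.re_sum]
  refine Finset.sum_congr rfl fun i _ => ?_
  rw [diag_apply, mul_diagonal, mul_apply, Finset.sum_mul, Complex.re_sum]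
  refine Finset.sum_congr rfl fun j _ => ?_
  rw [mul_diagonal, conjTranspose_apply]
  generalize (Wᴴ * V) i j = u
  simp only [Complex.normSq_apply, RCLike.star_def, Complex.mul_re, Complex.mul_im,
    Complex.conj_re, Complex.conj_im, Complex.ofReal_re, Complex.ofReal_im]
  ring

/-- The functional of `X` whose maximum is `Tr[A (L_B + s R_A)⁻¹ A]`, where `L_B` and `R_A` are
left multiplication by `B` and right multiplication by `A`. -/
def resolventFunctional (A B : Matrix n n ℂ) (s : ℝ) (X : Matrix n n ℂ) : ℝ :=
  2 * (Xᴴ * A).trace.re - (Xᴴ * B * X).trace.re - s * (X * A * Xᴴ).trace.re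

/-- In the coordinates X = W x V† both multiplications are diagonal, so the functional decouples
into one quadratic per entry of x. -/
theorem resolventFunctional_ofSpectrum {V W : Matrix n n ℂ} (hV : V ∈ unitaryGroup n ℂ)
    (hW : W ∈ unitaryGroup n ℂ) (a b : n → ℝ) (s : ℝ) (x : Matrix n n ℂ) :
    resolventFunctional (ofSpectrum V a) (ofSpectrum W b) s (W * x * Vᴴ) =
      ∑ k : n × n, (2 * a k.2 * ((x k.1 k.2).re * ((Wᴴ * V) k.1 k.2).re +
        (x k.1 k.2).im * ((Wᴴ * V) k.1 k.2).im) -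
        (b k.1 + s * a k.2) * ((x k.1 k.2).re ^ 2 + (x k.1 k.2).im ^ 2)) := by
  have cV : ∀ M : Matrix n n ℂ, Vᴴ * (V * M) = M := fun M => by
    rw [← Matrix.mul_assoc, conjTranspose_mul_self_of_mem hV, Matrix.one_mul]
  have cW : ∀ M : Matrix n n ℂ, Wᴴ * (W * M) = M := fun M => by
    rw [← Matrix.mul_assoc, conjTranspose_mul_self_of_mem hW, Matrix.one_mul]
  have h1 : ((W * x * Vᴴ)ᴴ * ofSpectrum V a).trace =
      ((Wᴴ * V) * diagonal (fun i => (a i : ℂ)) * xᴴ).trace := by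
    rw [trace_mul_comm ((Wᴴ * V) * _)]
    simp only [ofSpectrum, conjTranspose_mul, conjTranspose_conjTranspose, Matrix.mul_assoc]
    rw [trace_mul_comm]
    simp only [Matrix.mul_assoc, conjTranspose_mul_self_of_mem hV, Matrix.mul_one]
  have h2 : ((W * x * Vᴴ)ᴴ * ofSpectrum W b * (W * x * Vᴴ)).trace =
      (diagonal (fun i => (b i : ℂ)) * x * xᴴ).trace := by
    rw [trace_mul_comm (_ * x)]
    simp only [ofSpectrum, conjTranspose_mul, conjTranspose_conjTranspose, Matrix.mul_assoc, cW]
    rw [trace_mul_comm]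
    simp only [Matrix.mul_assoc, conjTranspose_mul_self_of_mem hV, Matrix.mul_one]
  have h3 : (W * x * Vᴴ * ofSpectrum V a * (W * x * Vᴴ)ᴴ).trace =
      (x * diagonal (fun i => (a i : ℂ)) * xᴴ).trace := by
    simp only [ofSpectrum, conjTranspose_mul, conjTranspose_conjTranspose, Matrix.mul_assoc, cV]
    rw [trace_mul_comm]
    simp only [Matrix.mul_assoc, conjTranspose_mul_self_of_mem hW, Matrix.mul_one]
  rw [resolventFunctional, h1, h2, h3, trace, trace, trace, Complex.re_sum, Complex.re_sum,
    Complex.re_sum, Fintype.sum_prod_type, Finset.mul_sum, Finset.mul_sum,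
    ← Finset.sum_sub_distrib, ← Finset.sum_sub_distrib]
  refine Finset.sum_congr rfl fun i _ => ?_
  simp only [diag_apply]
  rw [mul_apply, mul_apply, mul_apply, Complex.re_sum, Complex.re_sum, Complex.re_sum,
    Finset.mul_sum, Finset.mul_sum, ← Finset.sum_sub_distrib, ← Finset.sum_sub_distrib]
  refine Finset.sum_congr rfl fun j _ => ?_
  rw [mul_diagonal, mul_diagonal, diagonal_mul, conjTranspose_apply]
  simp
  ring

/-- For eigenpairs (α_j, v_j) of A and (β_i, w_i) of B, the weights are p_ij = α_j |⟨w_i, v_j⟩|²,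
with a = α_j and b = β_i. They reduce the noncommutative problem to scalar sums. -/
theorem exists_joint_spectral_weights {A B : Matrix n n ℂ} (hA : A.PosSemidef) (hB : B.PosSemidef)
    (h : supp A ≤ supp B) :
    ∃ p a b : n × n → ℝ, (∀ k, p k ≠ 0 → 0 < a k ∧ 0 < b k) ∧
      ∑ k, p k = A.trace.re ∧
      ((A * matLog A).trace - (A * matLog B).trace).re =
        ∑ k, p k * Real.log (a k) - ∑ k, p k * Real.log (b k) ∧
      ∀ s, 0 < s → IsGreatest (Set.range (resolventFunctional A B s))
        (∑ k, p k * (a k / (b k + s * a k))) := by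
  obtain ⟨V, hV, α, hA1, hA2⟩ := exists_eq_ofSpectrum hA.isHermitian
  obtain ⟨W, hW, β, hB1, hB2⟩ := exists_eq_ofSpectrum hB.isHermitian
  have hα : ∀ i, 0 ≤ α i := fun i => ofSpectrum_nonneg hV (hA1 ▸ hA) i
  have hβ : ∀ i, 0 ≤ β i := fun i => ofSpectrum_nonneg hW (hB1 ▸ hB) i
  have one_tr : ∀ a : n → ℝ, (ofSpectrum V a).trace.re =
      ∑ k : n × n, Complex.normSq ((Wᴴ * V) k.1 k.2) * a k.2 := fun a => by
    have := trace_ofSpectrum_mul_ofSpectrum V W a 1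
    rw [ofSpectrum_one hW, Matrix.mul_one] at this
    simpa using this
  refine ⟨fun k => Complex.normSq ((Wᴴ * V) k.1 k.2) * α k.2, fun k => α k.2, fun k => β k.1,
    ?_, ?_, ?_, ?_⟩
  · rintro ⟨i, j⟩ hk
    have hj : α j ≠ 0 := right_ne_zero_of_mul hk
    have hu : (Wᴴ * V) i j ≠ 0 := fun h0 => hk (by simp [h0])
    refine ⟨(hα j).lt_of_ne' hj, (hβ i).lt_of_ne' fun hi => ?_⟩
    obtain ⟨Y, hY⟩ := supp_le_supp_iff.1 h
    -- Since A = B Y, the coefficient ⟨w_i, v_j⟩ α_j carries a factor β_i, so it would vanish with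
    -- β_i.
    have h1 : (Wᴴ * V) * diagonal (fun i => (α i : ℂ)) =
        diagonal (fun i => (β i : ℂ)) * (Wᴴ * Y * V) := by
      calc _ = Wᴴ * A * V := by
            rw [hA1, ofSpectrum]
            simp only [Matrix.mul_assoc, conjTranspose_mul_self_of_mem hV, Matrix.mul_one]
        _ = (Wᴴ * W) * diagonal (fun i => (β i : ℂ)) * (Wᴴ * Y * V) := by
            rw [hY, hB1, ofSpectrum]
            simp only [Matrix.mul_assoc]
        _ = _ := by rw [conjTranspose_mul_self_of_mem hW, Matrix.one_mul]
    have h2 := congr_fun (congr_fun h1 i) j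
    rw [mul_diagonal, diagonal_mul, hi] at h2
    simp [hu, hj] at h2
  · rw [hA1, one_tr]
  · rw [matLog, matLog, hA2, hB2, hA1, Complex.sub_re, ofSpectrum_mul hV, one_tr,
      trace_ofSpectrum_mul_ofSpectrum]
    simp [mul_assoc]
  · intro s hs
    rw [hA1, hB1]
    constructor
    -- The stationary point of each scalar quadratic.
    · refine ⟨W * (of fun i j => ((α j / (β i + s * α j) : ℝ) : ℂ) * (Wᴴ * V) i j) * Vᴴ, ?_⟩
      rw [resolventFunctional_ofSpectrum hV hW]
      refine Finset.sum_congr rfl fun k _ => ?_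
      simp only [of_apply, Complex.re_ofReal_mul, Complex.im_ofReal_mul, Complex.normSq_apply]
      by_cases hk : α k.2 = 0
      · simp [hk]
      · have := hβ k.1
        have := mul_pos hs ((hα k.2).lt_of_ne' hk)
        have : β k.1 + s * α k.2 ≠ 0 := by positivity
        field_simp
        ring
    · rintro _ ⟨X, rfl⟩
      have hX : X = W * (Wᴴ * X * V) * Vᴴ := by
        simp only [← Matrix.mul_assoc, mul_conjTranspose_self_of_mem hW, Matrix.one_mul]
        rw [Matrix.mul_assoc, mul_conjTranspose_self_of_mem hV, Matrix.mul_one]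
      rw [hX, resolventFunctional_ofSpectrum hV hW]
      refine Finset.sum_le_sum fun k _ => ?_
      simp only [Complex.normSq_apply]
      generalize (Wᴴ * X * V) k.1 k.2 = x
      generalize (Wᴴ * V) k.1 k.2 = u
      have hb := hβ k.1
      -- The denominator may vanish when α_j = 0, but then the term is -β_i |x|² ≤ 0. Otherwise
      -- complete the square.
      rcases (hα k.2).eq_or_lt with hk | hk
      · rw [← hk]
        have : 0 ≤ β k.1 * (x.re ^ 2 + x.im ^ 2) := by positivity
        simpa using this
      · have hc : 0 < β k.1 + s * α k.2 := by positivity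
        generalize β k.1 + s * α k.2 = c at hc
        rw [← mul_div_assoc, le_div_iff₀ hc]
        nlinarith [sq_nonneg (c * x.re - α k.2 * u.re), sq_nonneg (c * x.im - α k.2 * u.im)]

theorem resolventFunctional_kronecker_one {S E : Type*} [Fintype S] [Fintype E]
    [DecidableEq E] (A B : Matrix (S × E) (S × E) ℂ) (s : ℝ) (X : Matrix S S ℂ) :
    resolventFunctional A B s (X ⊗ₖ (1 : Matrix E E ℂ)) =
      resolventFunctional (partialTrace A) (partialTrace B) s X := by
  simp only [resolventFunctional, conjTranspose_kronecker, conjTranspose_one]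
  rw [← trace_partialTrace, partialTrace_kronecker_one_mul, ← trace_partialTrace,
    partialTrace_mul_kronecker_one, partialTrace_kronecker_one_mul, ← trace_partialTrace,
    partialTrace_mul_kronecker_one, partialTrace_kronecker_one_mul]

section WeightedLog

variable {ι : Type*} [Fintype ι] {p a b : ι → ℝ}

theorem hasDerivAt_sum_mul_log (h : ∀ k, p k ≠ 0 → 0 < a k ∧ 0 < b k) {s : ℝ} (hs : 0 ≤ s) :
    HasDerivAt (fun s => ∑ k, p k * Real.log (b k + s * a k))
      (∑ k, p k * (a k / (b k + s * a k))) s := by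
  refine HasDerivAt.fun_sum fun k _ => ?_
  by_cases hk : p k = 0
  · simpa [hk] using hasDerivAt_const s (0 : ℝ)
  · obtain ⟨h1, h2⟩ := h k hk
    have h3 : HasDerivAt (fun s => b k + s * a k) (a k) s := by
      simpa using ((hasDerivAt_id s).mul_const (a k)).const_add (b k)
    exact (h3.log (by positivity)).const_mul (p k)

/-- For s > 0, log(b + s a) - log s = log(b/s + a). -/
theorem tendsto_sum_mul_log_sub (h : ∀ k, p k ≠ 0 → 0 < a k ∧ 0 < b k) :
    Tendsto (fun s => ∑ k, p k * Real.log (b k + s * a k) - (∑ k, p k) * Real.log s) atTop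
      (𝓝 (∑ k, p k * Real.log (a k))) := by
  simp only [Finset.sum_mul, ← Finset.sum_sub_distrib]
  refine tendsto_finsetSum _ fun k _ => ?_
  by_cases hk : p k = 0
  · simp [hk]
  · obtain ⟨h1, h2⟩ := h k hk
    have h3 : Tendsto (fun s : ℝ => p k * Real.log (b k * s⁻¹ + a k)) atTop
        (𝓝 (p k * Real.log (a k))) := by
      have : Tendsto (fun s : ℝ => b k * s⁻¹ + a k) atTop (𝓝 (b k * 0 + a k)) :=
        (tendsto_inv_atTop_zero.const_mul _).add_const _
      rw [mul_zero, zero_add] at this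
      exact (this.log h1.ne').const_mul _
    refine h3.congr' ?_
    filter_upwards [eventually_gt_atTop 0] with s hs
    rw [← mul_sub, ← Real.log_div (by positivity) hs.ne']
    congr 2
    field_simp

end WeightedLog

/-- If the resolvent sums `∑ p a / (b + s a)` of one family dominate those of another of the same mass, so do the
entropies `∑ p (log a - log b)`. -/
theorem sum_mul_log_sub_le {ι κ : Type*} [Fintype ι] [Fintype κ] {p a b : ι → ℝ} {q c d : κ → ℝ}
    (hp : ∀ k, p k ≠ 0 → 0 < a k ∧ 0 < b k) (hq : ∀ k, q k ≠ 0 → 0 < c k ∧ 0 < d k)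
    (hpq : ∑ k, p k = ∑ k, q k)
    (h : ∀ s, 0 < s → ∑ k, q k * (c k / (d k + s * c k)) ≤ ∑ k, p k * (a k / (b k + s * a k))) :
    ∑ k, q k * Real.log (c k) - ∑ k, q k * Real.log (d k) ≤
      ∑ k, p k * Real.log (a k) - ∑ k, p k * Real.log (b k) := by
  -- The hypothesis says G' ≥ 0 on s > 0, so the claim is G(0) ≤ lim G.
  set G : ℝ → ℝ := fun s => ∑ k, p k * Real.log (b k + s * a k) -
    ∑ k, q k * Real.log (d k + s * c k) with hG
  have hder : ∀ s, 0 ≤ s → HasDerivAt G (∑ k, p k * (a k / (b k + s * a k)) -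
      ∑ k, q k * (c k / (d k + s * c k))) s := fun s hs =>
    (hasDerivAt_sum_mul_log hp hs).sub (hasDerivAt_sum_mul_log hq hs)
  have hmono : MonotoneOn G (Set.Ici 0) := by
    refine monotoneOn_of_deriv_nonneg (convex_Ici 0)
      (fun s hs => (hder s hs).continuousAt.continuousWithinAt) ?_ ?_
    · rw [interior_Ici]
      exact fun s hs => (hder s (le_of_lt hs)).differentiableAt.differentiableWithinAt
    · rw [interior_Ici]
      intro s hs
      rw [(hder s (le_of_lt hs)).deriv, sub_nonneg]
      exact h s hs
  -- The divergent log s terms cancel because the total masses agree.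
  have hlim : Tendsto G atTop (𝓝 (∑ k, p k * Real.log (a k) - ∑ k, q k * Real.log (c k))) := by
    refine ((tendsto_sum_mul_log_sub hp).sub (tendsto_sum_mul_log_sub hq)).congr fun s => ?_
    rw [hpq, hG]
    ring
  have h0 : G 0 ≤ ∑ k, p k * Real.log (a k) - ∑ k, q k * Real.log (c k) := by
    refine ge_of_tendsto hlim ?_
    filter_upwards [eventually_ge_atTop 0] with s hs
    exact hmono (Set.mem_Ici.2 le_rfl) hs hs
  simp only [hG, zero_mul, add_zero] at h0
  linarith

/-- Monotonicity of the quantum relative entropy under the partial trace. -/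
theorem relEntropy_partialTrace_le {S E : Type*} [Fintype S] [DecidableEq S] [Fintype E]
    [DecidableEq E] {A B : Matrix (S × E) (S × E) ℂ} (hA : A.PosSemidef) (hB : B.PosSemidef) :
    relEntropy (partialTrace A) (partialTrace B) ≤ relEntropy A B := by
  by_cases h : supp A ≤ supp B
  · have h' := supp_partialTrace_le hB h
    rw [relEntropy, relEntropy, if_pos h, if_pos h']
    obtain ⟨p, a, b, hp, hp1, hp2, hp3⟩ := exists_joint_spectral_weights hA hB h
    obtain ⟨q, c, d, hq, hq1, hq2, hq3⟩ := exists_joint_spectral_weights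
      (posSemidef_partialTrace hA) (posSemidef_partialTrace hB) h'
    rw [hp2, hq2, EReal.coe_le_coe_iff]
    refine sum_mul_log_sub_le hp hq (by rw [hp1, hq1, trace_partialTrace]) fun s hs => ?_
    -- If X is optimal for the marginals, X ⊗ 1 is a competitor for A and B.
    obtain ⟨X, hX⟩ := (hq3 s hs).1
    rw [← hX, ← resolventFunctional_kronecker_one]
    exact (hp3 s hs).2 ⟨_, rfl⟩
  · rw [relEntropy.eq_1 A, if_neg h]
    exact le_top

end DataProcessing

/-! ### The reversed dilation: entropy identity and Petz map -/

section Recovery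

variable {S E : Type*} [Fintype S] [DecidableEq S] [Fintype E] [DecidableEq E]

theorem unitary_conj_conj {n : Type*} [Fintype n] [DecidableEq n] {U : Matrix n n ℂ}
    (hU : U ∈ unitaryGroup n ℂ) (M : Matrix n n ℂ) : Uᴴ * (U * M * Uᴴ) * U = M := by
  have h := conjTranspose_mul_self_of_mem hU
  calc _ = (Uᴴ * U) * M * (Uᴴ * U) := by simp only [Matrix.mul_assoc]
    _ = M := by rw [h, Matrix.one_mul, Matrix.mul_one]

/-- If `U` fixes `τ ⊗ ρE` with `τ` invertible, then `U (ρ ⊗ ρE) U†` is supported in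
the tensor product of the whole space with `supp ρE`. -/
theorem dilation_mul_suppProj {τ ρ : Matrix S S ℂ} {ρE : Matrix E E ℂ}
    {U : Matrix (S × E) (S × E) ℂ} (hτ : τ.PosDef) (hE : ρE.PosSemidef)
    (hcomm : τ ⊗ₖ ρE * Uᴴ = Uᴴ * (τ ⊗ₖ ρE)) :
    U * (ρ ⊗ₖ ρE) * Uᴴ * ((1 : Matrix S S ℂ) ⊗ₖ suppProj ρE) = U * (ρ ⊗ₖ ρE) * Uᴴ := by
  -- Factoring out τ ⊗ ρE lets it pass through U†, which puts ρE next to its support projection.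
  have h1 : ρ ⊗ₖ ρE = ((ρ * τ⁻¹) ⊗ₖ (1 : Matrix E E ℂ)) * (τ ⊗ₖ ρE) := by
    rw [← mul_kronecker_mul, Matrix.mul_assoc, nonsing_inv_mul _ ((isUnit_iff_isUnit_det _).1
      hτ.isUnit), Matrix.mul_one, Matrix.one_mul]
  have h2 : τ ⊗ₖ ρE * Uᴴ * ((1 : Matrix S S ℂ) ⊗ₖ suppProj ρE) = τ ⊗ₖ ρE * Uᴴ := by
    rw [hcomm, Matrix.mul_assoc, ← mul_kronecker_mul, mul_suppProj hE.isHermitian, Matrix.mul_one]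
  rw [h1]
  simp only [Matrix.mul_assoc] at h2 ⊢
  rw [h2]

theorem trace_mul_matLog_kronecker {τ ρ : Matrix S S ℂ} {ρE : Matrix E E ℂ}
    (hτ : τ.IsHermitian) (hE : IsState ρE) (hρ : ρ.trace = 1) (h : ρ * suppProj τ = ρ) :
    (ρ ⊗ₖ ρE * matLog (τ ⊗ₖ ρE)).trace =
      (ρ * matLog τ).trace + (ρE * matLog ρE).trace := by
  rw [matLog_kronecker hτ hE.1.isHermitian, Matrix.mul_add, ← mul_kronecker_mul,
    ← mul_kronecker_mul, mul_suppProj hE.1.isHermitian, h, trace_add, trace_kronecker,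
    trace_kronecker, hE.2, hρ, mul_one, one_mul]

/-- Although ω may be correlated, the support hypotheses absorb the projections from
`matLog_kronecker`, leaving two local observables. -/
theorem trace_mul_matLog_kronecker_of_supp {ω : Matrix (S × E) (S × E) ℂ} {σ : Matrix S S ℂ}
    {ρE : Matrix E E ℂ} (hσ : σ.IsHermitian) (hE : ρE.IsHermitian)
    (h1 : ω * (suppProj σ ⊗ₖ (1 : Matrix E E ℂ)) = ω)
    (h2 : ω * ((1 : Matrix S S ℂ) ⊗ₖ suppProj ρE) = ω) :
    (ω * matLog (σ ⊗ₖ ρE)).trace =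
      (partialTrace ω * matLog σ).trace + (ω * ((1 : Matrix S S ℂ) ⊗ₖ matLog ρE)).trace := by
  have e1 : ω * (matLog σ ⊗ₖ suppProj ρE) = ω * (matLog σ ⊗ₖ (1 : Matrix E E ℂ)) := by
    conv_rhs => rw [← h2, Matrix.mul_assoc, ← mul_kronecker_mul, Matrix.one_mul, Matrix.mul_one]
  have e2 : ω * (suppProj σ ⊗ₖ matLog ρE) = ω * ((1 : Matrix S S ℂ) ⊗ₖ matLog ρE) := by
    conv_rhs => rw [← h1, Matrix.mul_assoc, ← mul_kronecker_mul, Matrix.one_mul, Matrix.mul_one]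
  rw [matLog_kronecker hσ hE, Matrix.mul_add, trace_add, e1, e2, ← trace_partialTrace,
    partialTrace_mul_kronecker_one]

/-- Test against every X, split ρE into two square roots and cycle under the trace. -/
theorem hsAdjoint_dilation {T : Matrix S S ℂ →ₗ[ℂ] Matrix S S ℂ} {ρE : Matrix E E ℂ}
    {U : Matrix (S × E) (S × E) ℂ} (hE : ρE.PosSemidef)
    (hdil : ∀ X : Matrix S S ℂ, T X = partialTrace (U * (X ⊗ₖ ρE) * Uᴴ)) (Y : Matrix S S ℂ) :
    hsAdjoint T Y = partialTrace ((1 ⊗ₖ matPow ρE (1 / 2)) *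
      (Uᴴ * (Y ⊗ₖ 1) * U) * (1 ⊗ₖ matPow ρE (1 / 2))) := by
  have hT : ∀ X, (T X)ᴴ = partialTrace (U * (Xᴴ ⊗ₖ ρE) * Uᴴ) := fun X => by
    have h : ∀ M : Matrix (S × E) (S × E) ℂ, (partialTrace M)ᴴ = partialTrace Mᴴ := fun M => by
      ext i j
      simp [partialTrace]
    rw [hdil, h]
    simp only [conjTranspose_mul, conjTranspose_kronecker, conjTranspose_conjTranspose,
      hE.isHermitian.eq, Matrix.mul_assoc]
  rw [Matrix.ext_iff_trace_mul_left]
  intro X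
  have h1 := hsAdjoint_spec T Xᴴ Y
  rw [conjTranspose_conjTranspose] at h1
  have h2 : X ⊗ₖ ρE = (1 ⊗ₖ matPow ρE (1 / 2)) * (X ⊗ₖ (1 : Matrix E E ℂ)) *
      (1 ⊗ₖ matPow ρE (1 / 2)) := by
    rw [← mul_kronecker_mul, ← mul_kronecker_mul, Matrix.one_mul, Matrix.mul_one, Matrix.mul_one,
      matPow_half_mul_self hE]
  rw [h1, hT, conjTranspose_conjTranspose, ← partialTrace_kronecker_one_mul,
    ← partialTrace_mul_kronecker_one, trace_partialTrace, trace_partialTrace, h2]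
  simp only [Matrix.mul_assoc]
  rw [trace_mul_comm]
  simp only [Matrix.mul_assoc]
  rw [trace_mul_comm]
  simp only [Matrix.mul_assoc]

/-- The outer τ^{1/2} join the ρE^{1/2} of `hsAdjoint_dilation` to form K = τ^{1/2} ⊗ ρE^{1/2}.
Moving K through U and U† cancels the inner τ^{-1/2} and restores X ⊗ ρE. -/
theorem partialTrace_dilation_eq_petzMap {T : Matrix S S ℂ →ₗ[ℂ] Matrix S S ℂ}
    {τ : Matrix S S ℂ} {ρE : Matrix E E ℂ} {U : Matrix (S × E) (S × E) ℂ} (hτ : τ.PosDef)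
    (hE : ρE.PosSemidef) (hU : U ∈ unitaryGroup (S × E) ℂ) (hfix : T τ = τ)
    (hdil : ∀ X : Matrix S S ℂ, T X = partialTrace (U * (X ⊗ₖ ρE) * Uᴴ))
    (hcomm : U * (τ ⊗ₖ ρE) * Uᴴ = τ ⊗ₖ ρE) (X : Matrix S S ℂ) :
    partialTrace (Uᴴ * (X ⊗ₖ ρE) * U) = petzMap T τ X := by
  have hK : Uᴴ * (matPow τ (1 / 2) ⊗ₖ matPow ρE (1 / 2)) * U =
      matPow τ (1 / 2) ⊗ₖ matPow ρE (1 / 2) := by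
    rw [← matPow_kronecker hτ.posSemidef hE, matPow,
      ← cfc_unitary_conj hU (hτ.posSemidef.kronecker hE).isHermitian]
    conv_lhs => rw [← hcomm, unitary_conj_conj hU]
  have hUU := mul_conjTranspose_self_of_mem hU
  have hK1 : (matPow τ (1 / 2) ⊗ₖ matPow ρE (1 / 2)) * Uᴴ =
      Uᴴ * (matPow τ (1 / 2) ⊗ₖ matPow ρE (1 / 2)) := by
    conv_lhs => rw [← hK, Matrix.mul_assoc, hUU, Matrix.mul_one]
  have hK2 : U * (matPow τ (1 / 2) ⊗ₖ matPow ρE (1 / 2)) =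
      (matPow τ (1 / 2) ⊗ₖ matPow ρE (1 / 2)) * U := by
    conv_lhs => rw [← hK, ← Matrix.mul_assoc, ← Matrix.mul_assoc, hUU, Matrix.one_mul]
  rw [petzMap, hfix, hsAdjoint_dilation hE hdil, ← partialTrace_kronecker_one_mul,
    ← partialTrace_mul_kronecker_one]
  set Y := matPow τ (-1 / 2) * X * matPow τ (-1 / 2) with hY
  have e1 : (matPow τ (1 / 2) ⊗ₖ (1 : Matrix E E ℂ)) * ((1 : Matrix S S ℂ) ⊗ₖ matPow ρE (1 / 2)) =
      matPow τ (1 / 2) ⊗ₖ matPow ρE (1 / 2) := by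
    rw [← mul_kronecker_mul, Matrix.one_mul, Matrix.mul_one]
  have e2 : ((1 : Matrix S S ℂ) ⊗ₖ matPow ρE (1 / 2)) * (matPow τ (1 / 2) ⊗ₖ (1 : Matrix E E ℂ)) =
      matPow τ (1 / 2) ⊗ₖ matPow ρE (1 / 2) := by
    rw [← mul_kronecker_mul, Matrix.one_mul, Matrix.mul_one]
  have e3 : (matPow τ (1 / 2) ⊗ₖ matPow ρE (1 / 2)) * (Y ⊗ₖ 1) *
      (matPow τ (1 / 2) ⊗ₖ matPow ρE (1 / 2)) = X ⊗ₖ ρE := by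
    rw [← mul_kronecker_mul, ← mul_kronecker_mul, Matrix.mul_one, matPow_half_mul_self hE, hY]
    congr 1
    calc _ = (matPow τ (1 / 2) * matPow τ (-1 / 2)) * X *
          (matPow τ (-1 / 2) * matPow τ (1 / 2)) := by simp only [Matrix.mul_assoc]
      _ = X := by
        rw [matPow_mul_matPow_neg hτ _ _ (by norm_num), matPow_mul_matPow_neg hτ _ _ (by norm_num),
          Matrix.one_mul, Matrix.mul_one]
  congr 1
  symm
  calc _ = ((matPow τ (1 / 2) ⊗ₖ 1) * (1 ⊗ₖ matPow ρE (1 / 2))) * Uᴴ * (Y ⊗ₖ 1) *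
        (U * ((1 ⊗ₖ matPow ρE (1 / 2)) * (matPow τ (1 / 2) ⊗ₖ 1))) := by
        simp only [Matrix.mul_assoc]
    _ = Uᴴ * ((matPow τ (1 / 2) ⊗ₖ matPow ρE (1 / 2)) * (Y ⊗ₖ 1) *
        (matPow τ (1 / 2) ⊗ₖ matPow ρE (1 / 2))) * U := by
        rw [e1, e2, hK1, hK2]; simp only [Matrix.mul_assoc]
    _ = _ := by rw [e3]

/-- The loss of relative entropy to the fixed state is the relative entropy between the initial
state of the dilation and the reversed output. -/
theorem relEntropy_sub_relEntropy_dilation {τ ρ : Matrix S S ℂ} {ρE : Matrix E E ℂ}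
    {U : Matrix (S × E) (S × E) ℂ} (hτ : τ.PosDef) (hE : IsState ρE) (hρ : IsState ρ)
    (hU : U ∈ unitaryGroup (S × E) ℂ) (hcomm : U * (τ ⊗ₖ ρE) * Uᴴ = τ ⊗ₖ ρE) :
    relEntropy ρ τ - relEntropy (partialTrace (U * (ρ ⊗ₖ ρE) * Uᴴ)) τ =
      relEntropy (ρ ⊗ₖ ρE)
        (Uᴴ * (partialTrace (U * (ρ ⊗ₖ ρE) * Uᴴ) ⊗ₖ ρE) * U) := by
  have hω : (U * (ρ ⊗ₖ ρE) * Uᴴ).PosSemidef := (hρ.1.kronecker hE.1).mul_mul_conjTranspose_same U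
  have hτH := hτ.isHermitian
  have hEH := hE.1.isHermitian
  have hinv := unitary_conj_conj hU (ρ ⊗ₖ ρE)
  have hUτ : Uᴴ * (τ ⊗ₖ ρE) * U = τ ⊗ₖ ρE := by
    conv_lhs => rw [← hcomm, unitary_conj_conj hU]
  have h2 := dilation_mul_suppProj (ρ := ρ) hτ hE.1 (U := U) (by
    conv_lhs => rw [← hUτ, Matrix.mul_assoc, mul_conjTranspose_self_of_mem hU, Matrix.mul_one])
  have h1 := mul_suppProj_partialTrace hω
  set ω := U * (ρ ⊗ₖ ρE) * Uᴴ with hωdef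
  set σ := partialTrace ω with hσdef
  have hσ : σ.PosSemidef := posSemidef_partialTrace hω
  have hσH := hσ.isHermitian
  have hsupp : supp (ρ ⊗ₖ ρE) ≤ supp (Uᴴ * (σ ⊗ₖ ρE) * U) := by
    obtain ⟨Y, hY⟩ := exists_suppProj_eq_mul hσH
    obtain ⟨Z, hZ⟩ := exists_suppProj_eq_mul hEH
    -- Being supported on supp σ ⊗ supp ρE, ω factors through σ ⊗ ρE by means of pseudo-inverses.
    have h3 : ω * (suppProj σ ⊗ₖ suppProj ρE) = ω := by
      have : suppProj σ ⊗ₖ suppProj ρE =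
          (suppProj σ ⊗ₖ (1 : Matrix E E ℂ)) * (1 ⊗ₖ suppProj ρE) := by
        rw [← mul_kronecker_mul, Matrix.one_mul, Matrix.mul_one]
      rw [this, ← Matrix.mul_assoc, h1, h2]
    have h4 : (suppProj σ ⊗ₖ suppProj ρE) * ω = ω := by
      have := congr_arg conjTranspose h3
      rwa [conjTranspose_mul, conjTranspose_kronecker, conjTranspose_suppProj hσH,
        conjTranspose_suppProj hEH, hω.isHermitian.eq] at this
    rw [hY, hZ, mul_kronecker_mul] at h4
    refine supp_le_supp_iff.2 ⟨Uᴴ * ((Y ⊗ₖ Z) * ω) * U, ?_⟩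
    calc ρ ⊗ₖ ρE = Uᴴ * (σ ⊗ₖ ρE * (Y ⊗ₖ Z) * ω) * U := by rw [h4, hinv]
      _ = Uᴴ * (σ ⊗ₖ ρE) * 1 * ((Y ⊗ₖ Z) * ω) * U := by
        simp only [Matrix.mul_assoc, Matrix.one_mul]
      _ = _ := by
        rw [← mul_conjTranspose_self_of_mem hU]; simp only [Matrix.mul_assoc]
  have hcyc : ∀ ξ : Matrix S S ℂ, ξ.IsHermitian →
      (ρ ⊗ₖ ρE * matLog (Uᴴ * (ξ ⊗ₖ ρE) * U)).trace = (ω * matLog (ξ ⊗ₖ ρE)).trace :=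
    fun ξ hξ => by
      have hH : (ξ ⊗ₖ ρE).IsHermitian := by
        rw [IsHermitian, conjTranspose_kronecker, hξ.eq, hEH.eq]
      rw [matLog, cfc_unitary_conj hU hH, hωdef, ← Matrix.mul_assoc, trace_mul_comm, matLog]
      simp only [Matrix.mul_assoc]
  have t1 := trace_mul_matLog_kronecker hρ.1.isHermitian hE hρ.2 (mul_suppProj hρ.1.isHermitian)
  have t2 := trace_mul_matLog_kronecker hτH hE hρ.2 (by rw [suppProj_of_posDef hτ, Matrix.mul_one])
  have t3 := hcyc σ hσH
  rw [trace_mul_matLog_kronecker_of_supp hσH hEH h1 h2] at t3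
  -- Invariance of τ ⊗ ρE becomes the balance Tr[ρ log τ] + Tr[ρE log ρE] = Tr[σ log τ] + Tr[ω(1 ⊗
  -- log ρE)].
  have t4 := hcyc τ hτH
  rw [hUτ, t2, trace_mul_matLog_kronecker_of_supp hτH hEH
    (by rw [suppProj_of_posDef hτ, one_kronecker_one, Matrix.mul_one]) h2] at t4
  rw [relEntropy, relEntropy, relEntropy, if_pos (supp_le_supp_of_posDef hτ _),
    if_pos (supp_le_supp_of_posDef hτ _), if_pos hsupp,
    ← EReal.coe_sub, t1, t3, ← Complex.sub_re]
  congr 2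
  linear_combination -t4

theorem relEntropy_ne_top_of_posDef {n : Type*} [Fintype n] [DecidableEq n] {τ : Matrix n n ℂ}
    (hτ : τ.PosDef) (ρ : Matrix n n ℂ) : relEntropy ρ τ ≠ ⊤ := by
  rw [relEntropy, if_pos (supp_le_supp_of_posDef hτ ρ)]
  exact EReal.coe_ne_top _

end Recovery

end QRecovery

open QRecovery in
theorem lemma2 {S E : Type*} [Fintype S] [DecidableEq S] [Fintype E] [DecidableEq E]
    (T : Matrix S S ℂ →ₗ[ℂ] Matrix S S ℂ) (hT : IsChannel T)
    (τS : Matrix S S ℂ) (hτ : IsState τS) (hτ_full : τS.PosDef) (hτ_fix : T τS = τS)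
    (ρE : Matrix E E ℂ) (hρE : IsState ρE)
    (U : Matrix (S × E) (S × E) ℂ) (hU : U ∈ Matrix.unitaryGroup (S × E) ℂ)
    (hdil : ∀ X : Matrix S S ℂ, T X = partialTrace (U * (X ⊗ₖ ρE) * U.conjTranspose))
    (hcomm : U * (τS ⊗ₖ ρE) * U.conjTranspose = τS ⊗ₖ ρE) :
    (∀ ρS σS : Matrix S S ℂ, IsState ρS → σS = T ρS →
      relEntropy ρS τS ≠ ⊤ ∧ relEntropy σS τS ≠ ⊤ ∧
      relEntropy ρS τS - relEntropy σS τS =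
        relEntropy (ρS ⊗ₖ ρE) (U.conjTranspose * (σS ⊗ₖ ρE) * U) ∧
      relEntropy (ρS ⊗ₖ ρE) (U.conjTranspose * (σS ⊗ₖ ρE) * U) ≥
        relEntropy ρS (partialTrace (U.conjTranspose * (σS ⊗ₖ ρE) * U))) ∧
    (∀ X : Matrix S S ℂ,
      partialTrace (U.conjTranspose * (X ⊗ₖ ρE) * U) = petzMap T τS X) := by
  refine ⟨fun ρS σS hρ hσ => ⟨relEntropy_ne_top_of_posDef hτ_full _,
    relEntropy_ne_top_of_posDef hτ_full _, ?_, ?_⟩,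
    partialTrace_dilation_eq_petzMap hτ_full hρE.1 hU hτ_fix hdil hcomm⟩
  · rw [hσ, hdil]
    exact relEntropy_sub_relEntropy_dilation hτ_full hρE hρ hU hcomm
  · have hAρ := hρ.1.kronecker hρE.1
    have hσP : σS.PosSemidef := by
      rw [hσ, hdil]
      exact posSemidef_partialTrace (hAρ.mul_mul_conjTranspose_same U)
    -- The first marginal is ρ itself because Tr ρE = 1.
    have h := relEntropy_partialTrace_le hAρ
      ((hσP.kronecker hρE.1).conjTranspose_mul_mul_same U)
    rwa [partialTrace_kronecker, hρE.2, one_smul] at h
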